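/- Let $d\ge 0$ be an integer, let $\mathbb{D}$ be the open unit disc in $\mathbb{C}$, and let $f:\mathbb{D}^d\to\mathbb{C}$ be analytic, with Taylor series $f(z)=\sum_{\alpha\in\mathbb{N}_0^d} f_\alpha z^\alpha$ at the origin. For a $d$-tuple $T=(T_1,\dots,T_d)$ of pairwise commuting bounded operators on a complex Hilbert space put \[ f(T)=\sum_{\alpha\in\mathbb{N}_0^d} f_\alpha\, T_1^{\alpha_1}\cdots T_d^{\alpha_d} \] whenever this series converges unconditionally in operator norm. For a $d$-tuple $T$ of $n\times n$ complex matrices, regarded as operators on the Hilbert space $\mathbb{C}^n$, let $\sigma(T)\subset\mathbb{C}^d$ denote the set of joint eigenvalues, i.e. of the $\lambda\in\mathbb{C}^d$ for which there is $v\neq 0$ with $T_jv=\lambda_jv$ for all $j$; call $T$ simultaneously diagonalizable if $\mathbb{C}^n$ has a (not necessarily orthogonal) basis of joint eigenvectors of $T$. Then the following are equivalent. 1. For every complex Hilbert space $H$ and every $d$-tuple $T$ of pairwise commuting operators on $H$ with $\|T_j\|<1$ for all $j$, the operator $f(T)$ is defined and $\|f(T)\|\le 1$. 2. For every $n\in\mathbb{N}_0$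 and every $d$-tuple $T$ of pairwise commuting, simultaneously diagonalizable $n\times n$ matrices with $\|T_j\|\le 1$ for all $j$ and $\sigma(T)\subset\mathbb{D}^d$, the matrix $f(T)$ is defined and $\|f(T)\|\le 1$. -/

import Mathlib

universe u

noncomputable section

namespace VonNeumann

/-- The open unit polydisc in `ℂ^d`. -/
def polydisc (d : ℕ) : Set (Fin d → ℂ) := {z | ∀ j, ‖z j‖ < 1}

/-- The partial derivative `∂g/∂z_j`. -/
def partialDeriv {d : ℕ} (j : Fin d) (g : (Fin d → ℂ) → ℂ) : (Fin d → ℂ) → ℂ :=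
  fun z => lineDeriv ℂ g z (Pi.single j 1)

/-- The iterated partial derivative `∂_1^{α_1} ⋯ ∂_d^{α_d} g`. -/
def iteratedPartialDeriv {d : ℕ} (α : Fin d → ℕ) (g : (Fin d → ℂ) → ℂ) : (Fin d → ℂ) → ℂ :=
  (List.finRange d).foldr (fun j h => (partialDeriv j)^[α j] h) g

/-- The Taylor coefficient `f_α = (∂^α f)(0) / α!` at the origin. -/
def taylorCoeff {d : ℕ} (f : (Fin d → ℂ) → ℂ) (α : Fin d → ℕ) : ℂ :=
  iteratedPartialDeriv α f 0 / ∏ j, ((α j).factorial : ℂ)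

/-- The monomial `T^α = T_1^{α_1} ⋯ T_d^{α_d}` in a tuple. -/
def tuplePow {d : ℕ} {A : Type*} [Monoid A] (T : Fin d → A) (α : Fin d → ℕ) : A :=
  (List.ofFn fun j => T j ^ α j).prod

/-- `A = f(T)`, that is, `∑_α f_α T^α` converges (unconditionally, in operator norm) to `A`. -/
def HasValue {d : ℕ} {H : Type*} [NormedAddCommGroup H] [InnerProductSpace ℂ H]
    (f : (Fin d → ℂ) → ℂ) (T : Fin d → H →L[ℂ] H) (A : H →L[ℂ] H) : Prop :=
  HasSum (fun α : Fin d → ℕ => taylorCoeff f α • tuplePow T α) A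

/-- `f(T)` is defined and `‖f(T)‖ ≤ 1`. -/
def ValueContractive {d : ℕ} {H : Type*} [NormedAddCommGroup H] [InnerProductSpace ℂ H]
    (f : (Fin d → ℂ) → ℂ) (T : Fin d → H →L[ℂ] H) : Prop :=
  ∃ A : H →L[ℂ] H, HasValue f T A ∧ ‖A‖ ≤ 1

/-- The operators `T_1, …, T_d` commute pairwise. -/
def Commuting {d : ℕ} {H : Type*} [NormedAddCommGroup H] [InnerProductSpace ℂ H]
    (T : Fin d → H →L[ℂ] H) : Prop :=
  ∀ i j, T i * T j = T j * T i

/-- An `n × n` complex matrix, as an operator on the Hilbert space `ℂ^n`; its norm is the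
operator norm. -/
abbrev MatrixOp (n : ℕ) : Type := EuclideanSpace ℂ (Fin n) →L[ℂ] EuclideanSpace ℂ (Fin n)

/-- There is a (not necessarily orthogonal) basis of `ℂ^n` of joint eigenvectors. -/
def SimultaneouslyDiagonalizable {d n : ℕ} (T : Fin d → MatrixOp n) : Prop :=
  ∃ (b : Module.Basis (Fin n) ℂ (EuclideanSpace ℂ (Fin n))) (l : Fin n → Fin d → ℂ),
    ∀ k j, T j (b k) = l k j • b k

/-- The set `σ(T)` of joint eigenvalues of a tuple of matrices. -/
def jointSpectrum {d n : ℕ} (T : Fin d → MatrixOp n) : Set (Fin d → ℂ) :=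
  {l | ∃ v : EuclideanSpace ℂ (Fin n), v ≠ 0 ∧ ∀ j, T j v = l j • v}

end VonNeumann

end

noncomputable section

namespace VonNeumann

open scoped InnerProductSpace Topology
open Filter

/-! ### Monomials in a tuple -/

section Monomials

variable {d : ℕ} {A : Type*} [Monoid A]

/-! From matrices to operators: let `T` be commuting strict contractions. If the adjoints of a
commuting strictly contractive tuple `N` have joint eigenvectors with dense span, then `‖f(N)‖ ≤ 1`:
the span `W` of finitely many of them is invariant under the adjoints, so compression to `W`
respects `f`, and the compressed tuple is diagonalizable because its adjoints are
(`MatrixContractive.norm_apply_le_of_total`). A general `T` need not have such adjoint eigenvectors,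
but the shifts `S` on `ℓ²(ℕ^d)` do: the evaluation vectors. To combine the two, fix `x` and `δ > 0`
and let `L` send the basis vector `e_α` to `δ⁻¹ T^α x`. Then `L S_j = T_j L`, so the graph of `L` is
invariant under `T_j ⊕ S_j`. A graph vector is determined by its second coordinate, so evaluation at
the points of the polydisc separates graph vectors and the first case applies to `r (T_j ⊕ S_j)` on
the graph, for `0 < r < 1`. The vector `(x, δ e_0)` lies in the graph, whence `‖f(rT) x‖² ≤ ‖x‖² +
δ²`. Let `δ → 0`, and use `r⁻¹ T` for `T` (`MatrixContractive.norm_apply_le`). From operators to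
matrices: for diagonalizable `T`, `f(tT)` tends to `f(T)` as `t ↑ 1`, since only the values of `f`
at finitely many points of the open polydisc enter. -/

lemma tuplePow_fin_zero (T : Fin 0 → A) (α : Fin 0 → ℕ) : tuplePow T α = 1 := by
  simp [tuplePow]

lemma tuplePow_succ (T : Fin (d + 1) → A) (α : Fin (d + 1) → ℕ) :
    tuplePow T α = T 0 ^ α 0 * tuplePow (fun j => T j.succ) (fun j => α j.succ) := by
  simp [tuplePow, List.ofFn_succ]

lemma tuplePow_zero (T : Fin d → A) : tuplePow T 0 = 1 := by
  induction d with
  | zero => exact tuplePow_fin_zero T 0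
  | succ d ih =>
    rw [tuplePow_succ, Pi.zero_apply, pow_zero, one_mul]
    exact ih _

lemma tuplePow_add_single (T : Fin d → A) (hT : ∀ i j, T i * T j = T j * T i)
    (α : Fin d → ℕ) (j : Fin d) :
    tuplePow T (α + Pi.single j 1) = T j * tuplePow T α := by
  induction d with
  | zero => exact j.elim0
  | succ d ih =>
    rw [tuplePow_succ, tuplePow_succ]
    refine Fin.cases ?_ (fun i => ?_) j
    · have h : (fun i : Fin d => (α + Pi.single 0 1 : Fin (d + 1) → ℕ) i.succ)
          = fun i => α i.succ := by
        funext i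
        simp
      rw [h, ← mul_assoc]
      simp [pow_succ']
    · have h : (fun k : Fin d => (α + Pi.single i.succ 1 : Fin (d + 1) → ℕ) k.succ)
          = (fun k => α k.succ) + Pi.single i 1 := by
        funext k
        simp [Pi.single_apply, Fin.succ_inj]
      have hc : Commute (T 0 ^ α 0) (T i.succ) := Commute.pow_left (hT 0 i.succ) _
      have h0 : (α + Pi.single i.succ 1 : Fin (d + 1) → ℕ) 0 = α 0 := by
        simp
      rw [h, h0, ih _ (fun a b => hT _ _), ← mul_assoc, hc.eq, mul_assoc]

end Monomials

lemma tuplePow_intertwine {d : ℕ} {H K : Type*} [NormedAddCommGroup H] [InnerProductSpace ℂ H]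
    [NormedAddCommGroup K] [InnerProductSpace ℂ K] (Q : K →L[ℂ] H)
    (M : Fin d → K →L[ℂ] K) (T : Fin d → H →L[ℂ] H)
    (h : ∀ j v, Q (M j v) = T j (Q v)) (α : Fin d → ℕ) (v : K) :
    Q (tuplePow M α v) = tuplePow T α (Q v) := by
  induction d generalizing v with
  | zero => simp [tuplePow_fin_zero]
  | succ d ih =>
    have hp : ∀ (n : ℕ) (v : K), Q ((M 0 ^ n) v) = (T 0 ^ n) (Q v) := by
      intro n
      induction n with
      | zero => simp
      | succ n ihn =>
        intro v
        rw [pow_succ', pow_succ', mul_apply_eq_comp, mul_apply_eq_comp, h,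
          ihn]
    rw [tuplePow_succ, tuplePow_succ, mul_apply_eq_comp,
      mul_apply_eq_comp, hp, ih _ _ (fun j v => h j.succ v)]

lemma tuplePow_apply_eigenvector {d : ℕ} {H : Type*} [NormedAddCommGroup H]
    [InnerProductSpace ℂ H] (T : Fin d → H →L[ℂ] H) (l : Fin d → ℂ) (v : H)
    (h : ∀ j, T j v = l j • v) (α : Fin d → ℕ) :
    tuplePow T α v = (∏ j, l j ^ α j) • v := by
  induction d with
  | zero => simp [tuplePow_fin_zero]
  | succ d ih =>
    have hp : ∀ n : ℕ, (T 0 ^ n) v = l 0 ^ n • v := by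
      intro n
      induction n with
      | zero => simp
      | succ n ihn =>
        rw [pow_succ', mul_apply_eq_comp, ihn, map_smul, h, smul_smul, pow_succ]
    rw [tuplePow_succ, mul_apply_eq_comp, ih _ (fun j => l j.succ) (fun j => h j.succ),
      map_smul, hp, smul_smul, Fin.prod_univ_succ, mul_comm]

lemma norm_tuplePow_le {d : ℕ} {H : Type*} [NormedAddCommGroup H] [InnerProductSpace ℂ H]
    (T : Fin d → H →L[ℂ] H) (a : Fin d → ℝ) (ha : ∀ j, ‖T j‖ ≤ a j) (α : Fin d → ℕ) :
    ‖tuplePow T α‖ ≤ ∏ j, a j ^ α j := by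
  induction d with
  | zero =>
    rw [tuplePow_fin_zero, Fin.prod_univ_zero]
    exact ContinuousLinearMap.norm_id_le (𝕜 := ℂ) (E := H)
  | succ d ih =>
    have h0 : 0 ≤ a 0 := (norm_nonneg _).trans (ha 0)
    have hp : ∀ n : ℕ, ‖T 0 ^ n‖ ≤ a 0 ^ n := by
      intro n
      induction n with
      | zero =>
        rw [pow_zero, pow_zero]
        exact ContinuousLinearMap.norm_id_le (𝕜 := ℂ) (E := H)
      | succ n ihn =>
        rw [pow_succ', pow_succ']
        exact (norm_mul_le _ _).trans (mul_le_mul (ha 0) ihn (norm_nonneg _) h0)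
    rw [tuplePow_succ, Fin.prod_univ_succ]
    exact (norm_mul_le _ _).trans
      (mul_le_mul (hp _) (ih _ _ (fun j => ha j.succ) _) (norm_nonneg _) (pow_nonneg h0 _))

/-! ### Multiple geometric and power series -/

lemma summable_prod_pow {d : ℕ} (a : Fin d → ℝ) (h0 : ∀ j, 0 ≤ a j) (h1 : ∀ j, a j < 1) :
    Summable fun α : Fin d → ℕ => ∏ j, a j ^ α j := by
  induction d with
  | zero => exact Summable.of_finite
  | succ d ih =>
    rw [← (Fin.consEquiv fun _ : Fin (d + 1) => ℕ).summable_iff]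
    have := (summable_geometric_of_lt_one (h0 0) (h1 0)).mul_of_nonneg
      (ih (fun j => a j.succ) (fun j => h0 _) (fun j => h1 _))
      (fun n => pow_nonneg (h0 0) n) (fun α => Finset.prod_nonneg fun j _ => pow_nonneg (h0 _) _)
    refine this.congr fun p => ?_
    simp [Fin.consEquiv, Fin.prod_univ_succ]

/-- A power series in one variable with bounded coefficients that vanishes on the unit disc is
zero. -/
lemma coeff_eq_zero_of_tsum_eq_zero_one (g : ℕ → ℂ) (C : ℝ) (hC : ∀ n, ‖g n‖ ≤ C)
    (h : ∀ z : ℂ, ‖z‖ < 1 → ∑' n, g n * z ^ n = 0) : g = 0 := by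
  have hs : ∀ z : ℂ, ‖z‖ < 1 → Summable fun n => g n * z ^ n := fun z hz =>
    Summable.of_norm_bounded ((summable_geometric_of_lt_one (norm_nonneg z) hz).mul_left C)
      fun n => by
        rw [norm_mul, norm_pow]
        exact mul_le_mul_of_nonneg_right (hC n) (by positivity)
  -- Bounded coefficients give radius at least 1, so `g` is a power series of the zero function, and
  -- such a series is unique.
  have hp : HasFPowerSeriesOnBall (fun _ : ℂ => (0 : ℂ))
      (FormalMultilinearSeries.ofScalars ℂ g) 0 1 := by
    refine ⟨?_, one_pos, fun {y} hy => ?_⟩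
    · refine ENNReal.le_of_forall_nnreal_lt fun r hr => ?_
      refine FormalMultilinearSeries.le_radius_of_bound _ C fun n => ?_
      have hr1 : (r : ℝ) ≤ 1 := by exact_mod_cast hr.le
      rw [FormalMultilinearSeries.ofScalars_norm]
      calc ‖g n‖ * (r : ℝ) ^ n ≤ C * 1 := mul_le_mul (hC n) (pow_le_one₀ r.2 hr1) (by positivity)
            ((norm_nonneg _).trans (hC n))
        _ = C := mul_one C
    · have hy' : ‖y‖ < 1 := by
        rw [Metric.mem_eball, edist_zero_right, enorm_eq_nnnorm] at hy
        exact_mod_cast hy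
      have := (hs y hy').hasSum
      rw [h y hy'] at this
      simpa [FormalMultilinearSeries.ofScalars_apply_eq, smul_eq_mul, mul_comm] using this
  have := hp.hasFPowerSeriesAt.eq_zero
  funext n
  have hn := congrArg (fun p => p.coeff n) this
  rw [FormalMultilinearSeries.coeff_ofScalars] at hn
  rw [hn]
  rfl

/-- A multiple power series with bounded coefficients that vanishes on the polydisc is zero. -/
lemma coeff_eq_zero_of_tsum_eq_zero {d : ℕ} (g : (Fin d → ℕ) → ℂ) (C : ℝ) (hC : ∀ α, ‖g α‖ ≤ C)
    (h : ∀ z ∈ polydisc d, ∑' α, g α * ∏ j, z j ^ α j = 0) : g = 0 := by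
  induction d generalizing C with
  | zero =>
    funext α
    have := h 0 (fun j => j.elim0)
    rw [tsum_eq_single default (fun b hb => absurd (Subsingleton.elim _ _) hb)] at this
    simpa [Subsingleton.elim α default] using this
  | succ d ih =>
    have hsum : ∀ (n : ℕ) (w : Fin d → ℂ), w ∈ polydisc d →
        Summable fun β : Fin d → ℕ => ‖g (Fin.cons n β : Fin (d + 1) → ℕ)‖ * ∏ j, ‖w j‖ ^ β j :=
      fun n w hw => Summable.of_nonneg_of_le (fun β => by positivity)
        (fun β => mul_le_mul_of_nonneg_right (hC _) (by positivity))
        ((summable_prod_pow (fun j => ‖w j‖) (fun j => norm_nonneg _) hw).mul_left C)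
    -- With the last `d` variables frozen at `w`, this is a one-variable series whose coefficients
    -- are again bounded, with a bound depending on `w`.
    have key : ∀ w ∈ polydisc d,
        (fun n : ℕ => ∑' β : Fin d → ℕ, g (Fin.cons n β : Fin (d + 1) → ℕ) * ∏ j, w j ^ β j)
          = 0 := by
      intro w hw
      refine coeff_eq_zero_of_tsum_eq_zero_one _ (C * ∑' β : Fin d → ℕ, ∏ j, ‖w j‖ ^ β j) ?_ ?_
      · intro n
        have hb := (summable_prod_pow (fun j => ‖w j‖) (fun j => norm_nonneg _) hw).mul_left C
        rw [← tsum_mul_left]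
        refine tsum_of_norm_bounded hb.hasSum fun β => ?_
        rw [norm_mul, norm_prod]
        simp only [norm_pow]
        exact mul_le_mul_of_nonneg_right (hC _) (by positivity)
      · intro z hz
        have hzw : (Fin.cons z w : Fin (d + 1) → ℂ) ∈ polydisc (d + 1) := by
          intro j
          refine Fin.cases ?_ (fun i => ?_) j
          · simpa using hz
          · simpa using hw i
        have h1 := h _ hzw
        rw [← (Fin.consEquiv fun _ : Fin (d + 1) => ℕ).tsum_eq] at h1
        have hsm : Summable fun p : ℕ × (Fin d → ℕ) =>
            g (Fin.cons p.1 p.2 : Fin (d + 1) → ℕ) * (z ^ p.1 * ∏ j, w j ^ p.2 j) := by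
          have := ((summable_geometric_of_lt_one (norm_nonneg z) hz).mul_of_nonneg
            (summable_prod_pow (fun j => ‖w j‖) (fun j => norm_nonneg _) hw)
            (fun n => by positivity) (fun α => by positivity)).mul_left C
          refine Summable.of_norm_bounded this fun p => ?_
          rw [norm_mul, norm_mul, norm_prod, norm_pow]
          simp only [norm_pow]
          exact mul_le_mul_of_nonneg_right (hC _) (by positivity)
        rw [← h1]
        trans ∑' p : ℕ × (Fin d → ℕ),
            g (Fin.cons p.1 p.2 : Fin (d + 1) → ℕ) * (z ^ p.1 * ∏ j, w j ^ p.2 j)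
        · rw [hsm.tsum_prod]
          refine tsum_congr fun n => ?_
          rw [← tsum_mul_right]
          refine tsum_congr fun β => ?_
          ring
        · refine tsum_congr fun p => ?_
          simp [Fin.consEquiv, Fin.prod_univ_succ]
    have hz : ∀ n : ℕ, (fun β : Fin d → ℕ => g (Fin.cons n β : Fin (d + 1) → ℕ)) = 0 := fun n =>
      ih _ C (fun β => hC _) fun w hw => congrFun (key w hw) n
    funext α
    have := congrFun (hz (α 0)) (Fin.tail α)
    simpa [Fin.cons_self_tail] using this

/-! ### Matrix tuples and tuples on finite-dimensional Hilbert spaces -/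

/-- `f` is contractive on commuting, simultaneously diagonalizable tuples of contractive matrices
with joint spectrum in the polydisc. -/
def MatrixContractive {d : ℕ} (f : (Fin d → ℂ) → ℂ) : Prop :=
  ∀ (n : ℕ) (T : Fin d → MatrixOp n), Commuting T → (∀ j, ‖T j‖ ≤ 1) →
    SimultaneouslyDiagonalizable T → jointSpectrum T ⊆ polydisc d → ValueContractive f T

lemma norm_conjStarAlgEquiv {E E' : Type*} [NormedAddCommGroup E] [InnerProductSpace ℂ E]
    [CompleteSpace E] [NormedAddCommGroup E'] [InnerProductSpace ℂ E'] [CompleteSpace E']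
    (U : E ≃ₗᵢ[ℂ] E') (A : E →L[ℂ] E) : ‖U.conjStarAlgEquiv A‖ = ‖A‖ :=
  StarAlgEquiv.norm_map _ A

lemma ValueContractive.conj {d : ℕ} {f : (Fin d → ℂ) → ℂ} {E E' : Type*} [NormedAddCommGroup E]
    [InnerProductSpace ℂ E] [CompleteSpace E] [NormedAddCommGroup E'] [InnerProductSpace ℂ E']
    [CompleteSpace E'] (U : E ≃ₗᵢ[ℂ] E') {T : Fin d → E →L[ℂ] E} (h : ValueContractive f T) :
    ValueContractive f (fun j => U.conjStarAlgEquiv (T j)) := by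
  obtain ⟨A, hA, hA1⟩ := h
  refine ⟨U.conjStarAlgEquiv A, ?_, by rwa [norm_conjStarAlgEquiv]⟩
  have hsum := hA.map U.conjStarAlgEquiv (StarAlgEquiv.isometry U.conjStarAlgEquiv).continuous
  have hfun : (U.conjStarAlgEquiv ∘ fun α => taylorCoeff f α • tuplePow T α)
      = fun α => taylorCoeff f α • tuplePow (fun j => U.conjStarAlgEquiv (T j)) α := by
    funext α
    rw [Function.comp_apply, map_smul, tuplePow, tuplePow, map_list_prod, List.map_ofFn]
    simp [Function.comp_def]
  rw [hfun] at hsum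
  exact hsum

/-- Coordinate-free form of the hypothesis. The spectral condition is automatic here: a joint
eigenvalue satisfies `|μ_j| ≤ ‖X_j‖ < 1`. -/
lemma MatrixContractive.of_eigenbasis {d : ℕ} {f : (Fin d → ℂ) → ℂ} (hf : MatrixContractive f)
    {E : Type*} [NormedAddCommGroup E] [InnerProductSpace ℂ E] [FiniteDimensional ℂ E]
    (X : Fin d → E →L[ℂ] E) (hX : Commuting X) (hX1 : ∀ j, ‖X j‖ < 1) {n : ℕ}
    (b : Module.Basis (Fin n) ℂ E) (l : Fin n → Fin d → ℂ) (hb : ∀ k j, X j (b k) = l k j • b k) :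
    ValueContractive f X := by
  have hn : Module.finrank ℂ E = n := by simpa using Module.finrank_eq_card_basis b
  have : CompleteSpace E := FiniteDimensional.complete ℂ E
  let U : E ≃ₗᵢ[ℂ] EuclideanSpace ℂ (Fin n) :=
    (stdOrthonormalBasis ℂ E).repr.trans
      (LinearIsometryEquiv.piLpCongrLeft 2 ℂ ℂ (finCongr hn))
  have hY1 : ∀ j, ‖U.conjStarAlgEquiv (X j)‖ < 1 := fun j => by
    rw [norm_conjStarAlgEquiv]
    exact hX1 j
  have h := hf n (fun j => U.conjStarAlgEquiv (X j))
    (fun i j => by rw [← map_mul, ← map_mul, hX i j]) (fun j => (hY1 j).le)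
    ⟨b.map U.toLinearEquiv, l, fun k j => by
      simp [LinearIsometryEquiv.conjStarAlgEquiv_apply_apply, hb]⟩
    (by
      rintro μ ⟨v, hv, hμ⟩ j
      have h1 : ‖μ j‖ * ‖v‖ ≤ ‖U.conjStarAlgEquiv (X j)‖ * ‖v‖ := by
        rw [← norm_smul, ← hμ j]
        exact ContinuousLinearMap.le_opNorm _ _
      exact (le_of_mul_le_mul_right h1 (norm_pos_iff.2 hv)).trans_lt (hY1 j))
  have h' := h.conj U.symm
  convert h' using 1
  funext j
  ext v
  simp [LinearIsometryEquiv.conjStarAlgEquiv_apply_apply]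

/-- The dual vectors are the Riesz representatives of the coordinate functionals. They turn an
eigenbasis of the adjoints into an eigenbasis of the tuple itself. -/
lemma exists_dual_basis {n : ℕ} {E : Type*} [NormedAddCommGroup E] [InnerProductSpace ℂ E]
    (b : Module.Basis (Fin n) ℂ E) :
    ∃ b' : Module.Basis (Fin n) ℂ E, ∀ i k, ⟪b i, b' k⟫_ℂ = if i = k then 1 else 0 := by
  have : FiniteDimensional ℂ E := b.finiteDimensional_of_finite
  have : CompleteSpace E := FiniteDimensional.complete ℂ E
  let v : Fin n → E := fun k =>
    (InnerProductSpace.toDual ℂ E).symm (LinearMap.toContinuousLinearMap (b.coord k))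
  have hv : ∀ i k, ⟪b i, v k⟫_ℂ = if i = k then 1 else 0 := by
    intro i k
    rw [← inner_conj_symm, InnerProductSpace.toDual_symm_apply]
    simp [Finsupp.single_apply, apply_ite]
  have hli : LinearIndependent ℂ v := by
    rw [Fintype.linearIndependent_iff]
    intro c hc i
    have := congrArg (fun w => ⟪b i, w⟫_ℂ) hc
    simpa [inner_sum, inner_smul_right, hv] using this
  have hsp : ⊤ ≤ Submodule.span ℂ (Set.range v) := by
    rw [hli.span_eq_top_of_card_eq_finrank' (Module.finrank_eq_card_basis b).symm]
  exact ⟨Module.Basis.mk hli hsp, fun i k => by rw [Module.Basis.mk_apply, hv]⟩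

/-! ### Tuples whose adjoints have enough joint eigenvectors -/

section Total

variable {d : ℕ} {f : (Fin d → ℂ) → ℂ} {K : Type*} [NormedAddCommGroup K] [InnerProductSpace ℂ K]

/-- The joint eigenvectors of the adjoints of a tuple, together with zero. -/
def adjointEigenvectors (M : Fin d → K →L[ℂ] K) : Set K :=
  {v | ∃ μ : Fin d → ℂ, ∀ j m, ⟪v, M j m⟫_ℂ = μ j * ⟪v, m⟫_ℂ}

/-- The compression `X` of `M` to the span `W` of the `e k` is diagonalizable, and `P f(M) = f(X) P`
for the projection `P` onto `W`. Pairing with `w ∈ W` only sees `P (A y)`. -/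
lemma MatrixContractive.norm_inner_le_of_linearIndependent (hf : MatrixContractive f)
    (M : Fin d → K →L[ℂ] K) (hM : Commuting M) (hM1 : ∀ j, ‖M j‖ < 1) (A : K →L[ℂ] K)
    (hA : HasValue f M A) {n : ℕ} (e : Fin n → K) (he : LinearIndependent ℂ e)
    (heM : ∀ k, e k ∈ adjointEigenvectors M) (w : K)
    (hw : w ∈ Submodule.span ℂ (Set.range e)) (y : K) : ‖⟪w, A y⟫_ℂ‖ ≤ ‖w‖ * ‖y‖ := by
  choose μ hμ using heM
  set W := Submodule.span ℂ (Set.range e) with hW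
  have hWfin : FiniteDimensional ℂ W := FiniteDimensional.span_of_finite ℂ (Set.finite_range e)
  have : CompleteSpace W := FiniteDimensional.complete ℂ W
  let P : K →L[ℂ] W := W.orthogonalProjectionOnto
  let X : Fin d → W →L[ℂ] W := fun j => P ∘L M j ∘L W.subtypeL
  have hXapp : ∀ j u, X j u = P (M j u) := fun j u => rfl
  have hinner : ∀ (u : W) (m : K), ⟪u, P m⟫_ℂ = ⟪(u : K), m⟫_ℂ := fun u m =>
    Submodule.inner_orthogonalProjectionOnto_eq_of_mem_left u m
  obtain ⟨b', hb'⟩ := exists_dual_basis (Module.Basis.span he)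
  have hbW : ∀ k, ((Module.Basis.span he k : W) : K) = e k := fun k => by
    rw [Module.Basis.span_apply]
  have hext : ∀ u v : W, (∀ k, ⟪e k, (u : K)⟫_ℂ = ⟪e k, (v : K)⟫_ℂ) → u = v := by
    intro u v h
    refine InnerProductSpace.ext_inner_left_basis (𝕜 := ℂ) (Module.Basis.span he) fun k => ?_
    rw [Submodule.coe_inner, Submodule.coe_inner, hbW]
    exact h k
  have heP : ∀ k m, ⟪e k, (P m : K)⟫_ℂ = ⟪e k, m⟫_ℂ := fun k m => by
    have := hinner (Module.Basis.span he k) m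
    rwa [Submodule.coe_inner, hbW] at this
  -- `W` is invariant under the adjoints of `M`, so its orthogonal complement is invariant under
  -- `M`; tested against the `e k`, both sides give `μ k j * ⟪e k, m⟫`.
  have hint : ∀ j m, P (M j m) = X j (P m) := by
    intro j m
    refine hext _ _ fun k => ?_
    rw [hXapp, heP, heP, hμ, hμ, heP]
  have hPW : ∀ u : W, P (u : K) = u := fun u =>
    Submodule.orthogonalProjectionOnto_mem_subspace_eq_self u
  have hXc : Commuting X := by
    intro i j
    ext1 u
    rw [← hPW u, mul_apply_eq_comp, mul_apply_eq_comp, ← hint, ← hint, ← hint, ← hint,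
      ← mul_apply_eq_comp, ← mul_apply_eq_comp, hM i j]
  have hX1 : ∀ j, ‖X j‖ < 1 := by
    intro j
    refine lt_of_le_of_lt (ContinuousLinearMap.opNorm_le_bound _ (norm_nonneg (M j)) fun u => ?_)
      (hM1 j)
    rw [hXapp]
    exact (Submodule.norm_orthogonalProjectionOnto_apply_le W _).trans ((M j).le_opNorm _)
  have hXb : ∀ k j, X j (b' k) = μ k j • b' k := by
    intro k j
    refine hext _ _ fun i => ?_
    have h1 := hb' i k
    rw [Submodule.coe_inner, hbW] at h1
    rw [hXapp, heP, hμ, Submodule.coe_smul, inner_smul_right, h1]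
    split_ifs with hik
    · rw [hik]
    · simp
  obtain ⟨B, hB, hB1⟩ := hf.of_eigenbasis X hXc hX1 b' μ hXb
  have hBP : P (A y) = B (P y) := by
    have h1 : HasSum (fun α => taylorCoeff f α • tuplePow X α (P y)) (P (A y)) := by
      have := (P.comp (ContinuousLinearMap.apply ℂ K y)).hasSum hA
      simpa [tuplePow_intertwine P M X hint] using this
    have h2 : HasSum (fun α => taylorCoeff f α • tuplePow X α (P y)) (B (P y)) := by
      simpa using (ContinuousLinearMap.apply ℂ W (P y)).hasSum hB
    exact h1.unique h2
  have h3 : ⟪w, A y⟫_ℂ = ⟪(⟨w, hw⟩ : W), B (P y)⟫_ℂ := by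
    rw [← hBP, hinner]
  rw [h3]
  refine (norm_inner_le_norm _ _).trans (mul_le_mul_of_nonneg_left ?_ (norm_nonneg _))
  calc ‖B (P y)‖ ≤ 1 * ‖P y‖ := B.le_of_opNorm_le hB1 _
    _ ≤ ‖y‖ := by
      rw [one_mul]
      exact Submodule.norm_orthogonalProjectionOnto_apply_le W _

lemma MatrixContractive.norm_apply_le_of_total [CompleteSpace K] (hf : MatrixContractive f)
    (M : Fin d → K →L[ℂ] K) (hM : Commuting M) (hM1 : ∀ j, ‖M j‖ < 1) (A : K →L[ℂ] K)
    (hA : HasValue f M A)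
    (htot : ∀ m, (∀ v ∈ adjointEigenvectors M, ⟪v, m⟫_ℂ = 0) → m = 0) (y : K) :
    ‖A y‖ ≤ ‖y‖ := by
  have hspan : ∀ w ∈ Submodule.span ℂ (adjointEigenvectors M), ‖⟪w, A y⟫_ℂ‖ ≤ ‖w‖ * ‖y‖ := by
    intro w hw
    obtain ⟨F, hF, hwF⟩ := Submodule.mem_span_finite_of_mem_span hw
    -- A spanning set of eigenvectors is thinned to an independent one, so the vectors kept are
    -- still joint eigenvectors.
    obtain ⟨b, hbF, hbs, hbi⟩ := exists_linearIndependent ℂ (F : Set K)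
    have hfin : Finite b := (F.finite_toSet.subset hbF).to_subtype
    obtain ⟨n, ⟨φ⟩⟩ := Finite.exists_equiv_fin b
    refine hf.norm_inner_le_of_linearIndependent M hM hM1 A hA (fun k => (φ.symm k : K))
      (hbi.comp _ φ.symm.injective) (fun k => hF (hbF (φ.symm k).2)) w ?_ y
    have hr : Set.range (fun k => (φ.symm k : K)) = b := by
      rw [show (fun k => (φ.symm k : K)) = Subtype.val ∘ φ.symm from rfl,
        φ.symm.surjective.range_comp, Subtype.range_coe]
    rw [hr, hbs]
    exact hwF
  have hdense : (Submodule.span ℂ (adjointEigenvectors M)).topologicalClosure = ⊤ := by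
    rw [Submodule.topologicalClosure_eq_top_iff, Submodule.eq_bot_iff]
    intro m hm
    exact htot m fun v hv => (Submodule.mem_orthogonal _ _).1 hm v (Submodule.subset_span hv)
  have hclosed : IsClosed {w : K | ‖⟪w, A y⟫_ℂ‖ ≤ ‖w‖ * ‖y‖} :=
    isClosed_le (by fun_prop) (by fun_prop)
  -- By density the bound on the pairing holds for every `w`; the choice `w = A y` yields the norm
  -- bound.
  have hall : ‖⟪A y, A y⟫_ℂ‖ ≤ ‖A y‖ * ‖y‖ := by
    have hmem : A y ∈ (Submodule.span ℂ (adjointEigenvectors M)).topologicalClosure := by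
      rw [hdense]
      exact Submodule.mem_top
    exact closure_minimal hspan hclosed hmem
  rw [inner_self_eq_norm_sq_to_K] at hall
  rcases (norm_nonneg (A y)).eq_or_lt with h0 | h0
  · rw [← h0]
    exact norm_nonneg y
  · refine le_of_mul_le_mul_left ?_ h0
    simpa [sq] using hall

end Total

/-! ### Square summable families indexed by multi-indices -/

/-- The Hilbert space `ℓ²(ℕ^d)`. -/
abbrev MultiSeq (d : ℕ) : Type := lp (fun _ : Fin d → ℕ => ℂ) 2

namespace MultiSeq

lemma memℓp_iff {d : ℕ} {g : (Fin d → ℕ) → ℂ} :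
    Memℓp g 2 ↔ Summable fun α => ‖g α‖ ^ 2 := by
  rw [memℓp_gen_iff (by norm_num)]
  simp

lemma summable_norm_sq {d : ℕ} (g : MultiSeq d) : Summable fun α => ‖g α‖ ^ 2 :=
  memℓp_iff.1 (lp.memℓp g)

lemma norm_sq_eq {d : ℕ} (g : MultiSeq d) : ‖g‖ ^ 2 = ∑' α, ‖g α‖ ^ 2 := by
  have := lp.norm_rpow_eq_tsum (p := 2) (by norm_num) g
  simpa using this

/-- The backward shift in the direction `j`. -/
def backwardShift {d : ℕ} (j : Fin d) : MultiSeq d →L[ℂ] MultiSeq d :=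
  LinearMap.mkContinuous
    { toFun := fun g => ⟨fun α => g (α + Pi.single j 1), memℓp_iff.2
        ((summable_norm_sq g).comp_injective (add_left_injective (Pi.single j 1)))⟩
      map_add' := fun _ _ => rfl
      map_smul' := fun _ _ => rfl }
    1 fun g => by
      rw [one_mul]
      refine le_of_sq_le_sq ?_ (norm_nonneg _)
      rw [norm_sq_eq, norm_sq_eq]
      exact tsum_comp_le_tsum_of_inj (summable_norm_sq g) (fun _ => by positivity)
        (add_left_injective (Pi.single j 1))

lemma backwardShift_apply {d : ℕ} (j : Fin d) (g : MultiSeq d) (α : Fin d → ℕ) :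
    backwardShift j g α = g (α + Pi.single j 1) := rfl

lemma norm_backwardShift_le {d : ℕ} (j : Fin d) : ‖backwardShift j‖ ≤ 1 :=
  LinearMap.mkContinuous_norm_le _ zero_le_one _

lemma backwardShift_comm {d : ℕ} (i j : Fin d) :
    backwardShift i * backwardShift j = backwardShift j * backwardShift i := by
  ext g α
  rw [mul_apply_eq_comp, mul_apply_eq_comp, backwardShift_apply, backwardShift_apply,
    backwardShift_apply, backwardShift_apply, add_right_comm]

/-- The forward shift in the direction `j`. -/
def shift {d : ℕ} (j : Fin d) : MultiSeq d →L[ℂ] MultiSeq d :=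
  ContinuousLinearMap.adjoint (backwardShift j)

lemma norm_shift_le {d : ℕ} (j : Fin d) : ‖shift j‖ ≤ 1 := by
  rw [shift, LinearIsometryEquiv.norm_map]
  exact norm_backwardShift_le j

lemma shift_comm {d : ℕ} (i j : Fin d) : shift i * shift j = shift j * shift i := by
  have := congrArg star (backwardShift_comm j i)
  simpa only [star_mul, ContinuousLinearMap.star_eq_adjoint, shift] using this

/-- The vector representing evaluation of a power series at a point of the polydisc. -/
def evalVector {d : ℕ} (z : Fin d → ℂ) (hz : z ∈ polydisc d) : MultiSeq d :=
  ⟨fun α => (starRingEnd ℂ) (∏ j, z j ^ α j), memℓp_iff.2 (by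
    refine (summable_prod_pow (fun j => ‖z j‖ ^ 2) (fun j => by positivity)
      (fun j => pow_lt_one₀ (norm_nonneg _) (hz j) two_ne_zero)).congr fun α => ?_
    rw [RCLike.norm_conj, norm_prod, ← Finset.prod_pow]
    refine Finset.prod_congr rfl fun j _ => ?_
    rw [norm_pow, ← pow_mul, ← pow_mul, mul_comm])⟩

lemma inner_evalVector {d : ℕ} (z : Fin d → ℂ) (hz : z ∈ polydisc d) (g : MultiSeq d) :
    ⟪evalVector z hz, g⟫_ℂ = ∑' α, g α * ∏ j, z j ^ α j := by
  rw [lp.inner_eq_tsum]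
  refine tsum_congr fun α => ?_
  simp [evalVector]

/-- The shift is multiplication by the `j`-th variable, so its adjoint, the backward shift,
multiplies the evaluation vector by the conjugate of `z j`. -/
lemma inner_evalVector_shift {d : ℕ} (z : Fin d → ℂ) (hz : z ∈ polydisc d) (j : Fin d)
    (g : MultiSeq d) : ⟪evalVector z hz, shift j g⟫_ℂ = z j * ⟪evalVector z hz, g⟫_ℂ := by
  have h : backwardShift j (evalVector z hz) = (starRingEnd ℂ) (z j) • evalVector z hz := by
    ext α
    rw [backwardShift_apply]
    change (starRingEnd ℂ) (∏ i, z i ^ (α + Pi.single j 1 : Fin d → ℕ) i)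
      = (starRingEnd ℂ) (z j) * (starRingEnd ℂ) (∏ i, z i ^ α i)
    rw [← map_mul]
    congr 1
    simp_rw [Pi.add_apply, pow_add]
    rw [Finset.prod_mul_distrib, mul_comm]
    congr 1
    rw [Finset.prod_eq_single j (fun i _ hi => by simp [hi]) (by simp)]
    simp
  rw [shift, ContinuousLinearMap.adjoint_inner_right, h, inner_smul_left, RCLike.conj_conj]

lemma eq_zero_of_inner_evalVector {d : ℕ} (g : MultiSeq d)
    (h : ∀ z (hz : z ∈ polydisc d), ⟪evalVector z hz, g⟫_ℂ = 0) : g = 0 := by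
  have := coeff_eq_zero_of_tsum_eq_zero (fun α => g α) ‖g‖
    (fun α => lp.norm_apply_le_norm two_ne_zero g α)
    (fun z hz => by rw [← inner_evalVector z hz g, h z hz])
  ext α
  exact congrFun this α

/-- The analysis operator `h ↦ (⟨a_α, h⟩)_α` of a square summable family of vectors. -/
def analysis {d : ℕ} {H : Type*} [NormedAddCommGroup H] [InnerProductSpace ℂ H]
    (a : (Fin d → ℕ) → H) (ha : Summable fun α => ‖a α‖ ^ 2) : H →L[ℂ] MultiSeq d :=
  have hle : ∀ h α, ‖⟪a α, h⟫_ℂ‖ ^ 2 ≤ ‖a α‖ ^ 2 * ‖h‖ ^ 2 := fun h α => by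
    rw [← mul_pow]
    exact pow_le_pow_left₀ (norm_nonneg _) (norm_inner_le_norm _ _) 2
  have hs : ∀ h, Summable fun α => ‖⟪a α, h⟫_ℂ‖ ^ 2 := fun h =>
    Summable.of_nonneg_of_le (fun _ => by positivity) (hle h) (ha.mul_right _)
  LinearMap.mkContinuous
    { toFun := fun h => ⟨fun α => ⟪a α, h⟫_ℂ, memℓp_iff.2 (hs h)⟩
      map_add' := fun h h' => by
        ext α
        exact inner_add_right _ _ _
      map_smul' := fun c h => by
        ext α
        exact inner_smul_right _ _ _ }
    (√(∑' α, ‖a α‖ ^ 2)) fun h => by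
      refine le_of_sq_le_sq ?_ (by positivity)
      rw [norm_sq_eq, mul_pow, Real.sq_sqrt (tsum_nonneg fun _ => by positivity), ← tsum_mul_right]
      exact (hs h).tsum_le_tsum (hle h) (ha.mul_right _)

lemma analysis_apply {d : ℕ} {H : Type*} [NormedAddCommGroup H] [InnerProductSpace ℂ H]
    (a : (Fin d → ℕ) → H) (ha : Summable fun α => ‖a α‖ ^ 2) (h : H) (α : Fin d → ℕ) :
    analysis a ha h α = ⟪a α, h⟫_ℂ := rfl

end MultiSeq

/-! ### Lifting a tuple to multiplication operators -/

open MultiSeq in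
/-- A commuting tuple of strict contractions intertwines with the shifts on `ℓ²(ℕ^d)`, with the
constant power series mapped to a prescribed vector. -/
lemma exists_intertwining {d : ℕ} {H : Type*} [NormedAddCommGroup H] [InnerProductSpace ℂ H]
    [CompleteSpace H] (T : Fin d → H →L[ℂ] H) (hT : Commuting T) (hT1 : ∀ j, ‖T j‖ < 1) (x : H) :
    ∃ (L : MultiSeq d →L[ℂ] H) (e : MultiSeq d), ‖e‖ = 1 ∧ L e = x ∧
      ∀ j g, L (shift j g) = T j (L g) := by
  -- Strictness of `‖T j‖ < 1` makes the orbit square summable, which is what bounds the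
  -- intertwiner.
  have ha : Summable fun α => ‖tuplePow T α x‖ ^ 2 := by
    have hs := (summable_prod_pow (fun j => ‖T j‖ ^ 2) (fun j => by positivity)
      (fun j => pow_lt_one₀ (norm_nonneg _) (hT1 j) two_ne_zero)).mul_right (‖x‖ ^ 2)
    refine Summable.of_nonneg_of_le (fun _ => by positivity) (fun α => ?_) hs
    have h1 : ‖tuplePow T α x‖ ≤ (∏ j, ‖T j‖ ^ α j) * ‖x‖ :=
      ContinuousLinearMap.le_of_opNorm_le _ (norm_tuplePow_le T _ (fun _ => le_rfl) α) x
    calc ‖tuplePow T α x‖ ^ 2 ≤ ((∏ j, ‖T j‖ ^ α j) * ‖x‖) ^ 2 :=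
          pow_le_pow_left₀ (norm_nonneg _) h1 2
      _ = (∏ j, (‖T j‖ ^ 2) ^ α j) * ‖x‖ ^ 2 := by
          rw [mul_pow, ← Finset.prod_pow]
          simp_rw [← pow_mul, mul_comm]
  -- The adjoint of the analysis operator is the synthesis operator `g ↦ ∑ g_α T^α x`; the vector
  -- `e` is the basis vector at the multi-index 0.
  refine ⟨ContinuousLinearMap.adjoint (analysis (fun α => tuplePow T α x) ha),
    lp.single 2 0 1, ?_, ?_, fun j g => ?_⟩
  · rw [lp.norm_single (by norm_num)]
    simp
  · refine ext_inner_right ℂ fun h => ?_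
    rw [ContinuousLinearMap.adjoint_inner_left, lp.inner_single_left, analysis_apply, tuplePow_zero]
    simp
  · refine ext_inner_right ℂ fun h => ?_
    rw [ContinuousLinearMap.adjoint_inner_left, shift, ContinuousLinearMap.adjoint_inner_left,
      ← ContinuousLinearMap.adjoint_inner_right (T j), ContinuousLinearMap.adjoint_inner_left]
    congr 1
    ext α
    rw [backwardShift_apply, analysis_apply, analysis_apply,
      ContinuousLinearMap.adjoint_inner_right, tuplePow_add_single T hT, mul_apply_eq_comp]

/-! ### The graph of an intertwiner as an invariant subspace of the direct sum -/

section Graph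

variable {d : ℕ} {H : Type*} [NormedAddCommGroup H] [InnerProductSpace ℂ H]

/-- The graph of an operator on `ℓ²(ℕ^d)`, as a subspace of the Hilbert space direct sum. -/
def graphSpace (L : MultiSeq d →L[ℂ] H) : Submodule ℂ (WithLp 2 (H × MultiSeq d)) :=
  (WithLp.fstL 2 ℂ H (MultiSeq d) - L ∘L WithLp.sndL 2 ℂ H (MultiSeq d)).ker

lemma mem_graphSpace {L : MultiSeq d →L[ℂ] H} {p : WithLp 2 (H × MultiSeq d)} :
    p ∈ graphSpace L ↔ p.fst = L p.snd := by
  simp [graphSpace, sub_eq_zero]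

lemma isClosed_graphSpace (L : MultiSeq d →L[ℂ] H) :
    IsClosed (graphSpace L : Set (WithLp 2 (H × MultiSeq d))) :=
  ContinuousLinearMap.isClosed_ker _

/-- The direct sum of `T_j` and the shift. -/
def sumShift (T : Fin d → H →L[ℂ] H) (j : Fin d) :
    WithLp 2 (H × MultiSeq d) →L[ℂ] WithLp 2 (H × MultiSeq d) :=
  (WithLp.prodContinuousLinearEquiv 2 ℂ H (MultiSeq d)).symm.toContinuousLinearMap ∘L
    ((T j).prodMap (MultiSeq.shift j)) ∘L
    (WithLp.prodContinuousLinearEquiv 2 ℂ H (MultiSeq d)).toContinuousLinearMap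

lemma sumShift_fst (T : Fin d → H →L[ℂ] H) (j : Fin d) (p : WithLp 2 (H × MultiSeq d)) :
    (sumShift T j p).fst = T j p.fst := rfl

lemma sumShift_snd (T : Fin d → H →L[ℂ] H) (j : Fin d) (p : WithLp 2 (H × MultiSeq d)) :
    (sumShift T j p).snd = MultiSeq.shift j p.snd := rfl

lemma sumShift_comm (T : Fin d → H →L[ℂ] H) (hT : Commuting T) (i j : Fin d)
    (p : WithLp 2 (H × MultiSeq d)) :
    sumShift T i (sumShift T j p) = sumShift T j (sumShift T i p) := by
  refine WithLp.ofLp_injective 2 (Prod.ext ?_ ?_)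
  · exact congrArg (fun A => A p.fst) (hT i j)
  · exact congrArg (fun A => A p.snd) (MultiSeq.shift_comm i j)

lemma norm_sumShift_apply_le (T : Fin d → H →L[ℂ] H) (hT1 : ∀ j, ‖T j‖ ≤ 1) (j : Fin d)
    (p : WithLp 2 (H × MultiSeq d)) : ‖sumShift T j p‖ ≤ ‖p‖ := by
  refine le_of_sq_le_sq ?_ (norm_nonneg _)
  rw [WithLp.prod_norm_sq_eq_of_L2, WithLp.prod_norm_sq_eq_of_L2, sumShift_fst, sumShift_snd]
  have h1 : ‖T j p.fst‖ ≤ ‖p.fst‖ := by simpa using (T j).le_of_opNorm_le (hT1 j) p.fst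
  have h2 : ‖MultiSeq.shift j p.snd‖ ≤ ‖p.snd‖ := by
    simpa using (MultiSeq.shift j).le_of_opNorm_le (MultiSeq.norm_shift_le j) p.snd
  gcongr

lemma sumShift_mem_graphSpace (T : Fin d → H →L[ℂ] H) {L : MultiSeq d →L[ℂ] H}
    (hL : ∀ j g, L (MultiSeq.shift j g) = T j (L g)) (j : Fin d) :
    ∀ p ∈ graphSpace L, sumShift T j p ∈ graphSpace L := by
  intro p hp
  rw [mem_graphSpace] at hp ⊢
  rw [sumShift_fst, sumShift_snd, hL, hp]

end Graph

/-! ### Convergence and the main estimate -/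

/-- Convergence of the power series at strict contractions, from convergence on the polydisc. -/
lemma exists_hasValue {d : ℕ} {f : (Fin d → ℂ) → ℂ}
    (hs : ∀ z ∈ polydisc d, Summable fun α => ‖taylorCoeff f α‖ * ∏ j, ‖z j‖ ^ α j)
    {H : Type*} [NormedAddCommGroup H] [InnerProductSpace ℂ H] [CompleteSpace H]
    (T : Fin d → H →L[ℂ] H) (hT1 : ∀ j, ‖T j‖ < 1) : ∃ A, HasValue f T A := by
  have h := hs (fun j => (‖T j‖ : ℂ)) (fun j => by simpa using hT1 j)
  refine ⟨_, (Summable.of_norm_bounded h fun α => ?_).hasSum⟩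
  rw [norm_smul]
  refine mul_le_mul_of_nonneg_left ?_ (norm_nonneg _)
  exact norm_tuplePow_le T _ (fun j => by simp) α

/-- The main estimate: a function that is contractive on diagonalizable matrix tuples is
contractive on uniformly strict contractions. -/
lemma MatrixContractive.norm_apply_le {d : ℕ} {f : (Fin d → ℂ) → ℂ} (hf : MatrixContractive f)
    (hs : ∀ z ∈ polydisc d, Summable fun α => ‖taylorCoeff f α‖ * ∏ j, ‖z j‖ ^ α j)
    {H : Type*} [NormedAddCommGroup H] [InnerProductSpace ℂ H] [CompleteSpace H]
    (T : Fin d → H →L[ℂ] H) (hT : Commuting T) (hT1 : ∀ j, ‖T j‖ < 1) {r : ℝ} (hr0 : 0 < r)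
    (hr1 : r < 1) (B : H →L[ℂ] H) (hB : HasValue f (fun j => (r : ℂ) • T j) B) (x : H) {δ : ℝ}
    (hδ : 0 < δ) : ‖B x‖ ^ 2 ≤ ‖x‖ ^ 2 + δ ^ 2 := by
  -- Scaling by `δ⁻¹` puts `(x, δ e)` in the graph of `L`, so the second coordinate costs only `δ ^
  -- 2` in the squared norm.
  obtain ⟨L, e, he, hLe, hL⟩ := exists_intertwining T hT hT1 ((δ : ℂ)⁻¹ • x)
  have hδ' : (δ : ℂ) ≠ 0 := by exact_mod_cast hδ.ne'
  have : CompleteSpace (graphSpace L) := (isClosed_graphSpace L).completeSpace_coe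
  have hinv := sumShift_mem_graphSpace T hL
  -- The shifts are contractions but not strict ones; the factor `r` makes the tuple strict.
  let N : Fin d → graphSpace L →L[ℂ] graphSpace L := fun j =>
    (r : ℂ) • (sumShift T j).restrict (hinv j)
  have hN : ∀ j m, (N j m : WithLp 2 (H × MultiSeq d)) = (r : ℂ) • sumShift T j m :=
    fun j m => rfl
  have hNc : Commuting N := by
    intro i j
    ext1 m
    refine Subtype.ext ?_
    rw [mul_apply_eq_comp, mul_apply_eq_comp, hN, hN, hN, hN, map_smul, map_smul,
      sumShift_comm T hT]
  have hN1 : ∀ j, ‖N j‖ < 1 := by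
    intro j
    refine lt_of_le_of_lt (ContinuousLinearMap.opNorm_le_bound _ hr0.le fun m => ?_) hr1
    rw [Submodule.coe_norm, hN, norm_smul, Complex.norm_real, Real.norm_of_nonneg hr0.le]
    exact mul_le_mul_of_nonneg_left (norm_sumShift_apply_le T (fun j => (hT1 j).le) j _) hr0.le
  obtain ⟨A, hA⟩ := exists_hasValue hs N hN1
  -- On the graph, evaluation of the second coordinate at `z` is represented by the projection of
  -- `(0, evalVector z hz)`; this is the adjoint eigenvector, with `μ j = r * z j`.
  have hpair : ∀ z (hz : z ∈ polydisc d) (m : graphSpace L),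
      ⟪(graphSpace L).orthogonalProjectionOnto (WithLp.toLp 2 (0, MultiSeq.evalVector z hz)), m⟫_ℂ
        = ⟪MultiSeq.evalVector z hz, (m : WithLp 2 (H × MultiSeq d)).snd⟫_ℂ := by
    intro z hz m
    rw [Submodule.inner_orthogonalProjectionOnto_eq_of_mem_right, WithLp.prod_inner_apply]
    simp
  have htot : ∀ m, (∀ v ∈ adjointEigenvectors N, ⟪v, m⟫_ℂ = 0) → m = 0 := by
    intro m hm
    have hsnd : (m : WithLp 2 (H × MultiSeq d)).snd = 0 := by
      refine MultiSeq.eq_zero_of_inner_evalVector _ fun z hz => ?_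
      rw [← hpair z hz m]
      refine hm _ ⟨fun j => r * z j, fun j u => ?_⟩
      rw [hpair, hpair, hN, WithLp.smul_snd, inner_smul_right, sumShift_snd,
        MultiSeq.inner_evalVector_shift, mul_assoc]
    have hfst : (m : WithLp 2 (H × MultiSeq d)).fst = 0 := by
      rw [mem_graphSpace.1 m.2, hsnd, map_zero]
    exact Subtype.ext (WithLp.ofLp_injective 2 (Prod.ext hfst hsnd))
  let y : graphSpace L := ⟨WithLp.toLp 2 (x, (δ : ℂ) • e), by
    rw [mem_graphSpace]
    change x = L ((δ : ℂ) • e)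
    rw [map_smul, hLe, smul_smul, mul_inv_cancel₀ hδ', one_smul]⟩
  have hy : ‖y‖ ^ 2 = ‖x‖ ^ 2 + δ ^ 2 := by
    rw [Submodule.coe_norm, WithLp.prod_norm_sq_eq_of_L2]
    change ‖x‖ ^ 2 + ‖(δ : ℂ) • e‖ ^ 2 = _
    rw [norm_smul, he, mul_one, Complex.norm_real, Real.norm_of_nonneg hδ.le]
  let Q : graphSpace L →L[ℂ] H := WithLp.fstL 2 ℂ H (MultiSeq d) ∘L (graphSpace L).subtypeL
  have hQ : ∀ m, Q m = (m : WithLp 2 (H × MultiSeq d)).fst := fun m => rfl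
  have hQN : ∀ j m, Q (N j m) = ((r : ℂ) • T j) (Q m) := fun j m => rfl
  have hBx : B x = Q (A y) := by
    have h1 : HasSum (fun α => taylorCoeff f α • tuplePow (fun j => (r : ℂ) • T j) α x) (B x) := by
      simpa using (ContinuousLinearMap.apply ℂ H x).hasSum hB
    have h2 : HasSum (fun α => taylorCoeff f α • tuplePow (fun j => (r : ℂ) • T j) α x)
        (Q (A y)) := by
      have := (Q.comp (ContinuousLinearMap.apply ℂ (graphSpace L) y)).hasSum hA
      have hQy : Q y = x := rfl
      simpa [tuplePow_intertwine Q N _ hQN, hQy] using this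
    exact h1.unique h2
  have hQle : ‖Q (A y)‖ ^ 2 ≤ ‖A y‖ ^ 2 := by
    rw [hQ, Submodule.coe_norm, WithLp.prod_norm_sq_eq_of_L2]
    exact le_add_of_nonneg_right (by positivity)
  calc ‖B x‖ ^ 2 ≤ ‖A y‖ ^ 2 := by rw [hBx]; exact hQle
    _ ≤ ‖y‖ ^ 2 :=
      pow_le_pow_left₀ (norm_nonneg _) (hf.norm_apply_le_of_total N hNc hN1 A hA htot y) 2
    _ = ‖x‖ ^ 2 + δ ^ 2 := hy

/-! ### The equivalence -/

/-- Applying the functional `B ↦ ⟪v, B v⟫` to the operator series leaves the scalar series at `z`,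
times `‖v‖ ^ 2`. Unconditional convergence of scalars is absolute. -/
lemma HasValue.summable_of_eigenvector {d : ℕ} {f : (Fin d → ℂ) → ℂ} {H : Type*}
    [NormedAddCommGroup H] [InnerProductSpace ℂ H] {T : Fin d → H →L[ℂ] H} {A : H →L[ℂ] H}
    (hA : HasValue f T A) {z : Fin d → ℂ} {v : H} (hv : v ≠ 0) (hT : ∀ j, T j v = z j • v) :
    Summable fun α => ‖taylorCoeff f α‖ * ∏ j, ‖z j‖ ^ α j := by
  have h := (((innerSL ℂ v).comp (ContinuousLinearMap.apply ℂ H v)).hasSum hA).summable.norm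
  have hv2 : ‖v‖ ^ 2 ≠ 0 := pow_ne_zero 2 (norm_ne_zero_iff.2 hv)
  rw [← summable_mul_right_iff hv2]
  refine h.congr fun α => ?_
  simp [tuplePow_apply_eigenvector T z v hT, mul_assoc]

/-- Points of the polydisc are tested as tuples of `1 × 1` matrices. -/
lemma MatrixContractive.summable {d : ℕ} {f : (Fin d → ℂ) → ℂ} (hf : MatrixContractive f)
    (z : Fin d → ℂ) (hz : z ∈ polydisc d) :
    Summable fun α => ‖taylorCoeff f α‖ * ∏ j, ‖z j‖ ^ α j := by
  have hnorm : ∀ j, ‖z j • (1 : MatrixOp 1)‖ < 1 := fun j => by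
    rw [norm_smul, norm_one, mul_one]
    exact hz j
  obtain ⟨A, hA, -⟩ := hf.of_eigenbasis (E := EuclideanSpace ℂ (Fin 1))
    (fun j => z j • (1 : MatrixOp 1)) (fun i j => by simp [smul_smul, mul_comm]) hnorm
    (EuclideanSpace.basisFun (Fin 1) ℂ).toBasis (fun _ => z) (fun k j => by simp)
  exact hA.summable_of_eigenvector (v := EuclideanSpace.single 0 1) (by simp) (fun j => by simp)

lemma MatrixContractive.valueContractive {d : ℕ} {f : (Fin d → ℂ) → ℂ} (hf : MatrixContractive f)
    {H : Type*} [NormedAddCommGroup H] [InnerProductSpace ℂ H] [CompleteSpace H]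
    (T : Fin d → H →L[ℂ] H) (hT : Commuting T) (hT1 : ∀ j, ‖T j‖ < 1) : ValueContractive f T := by
  obtain ⟨B, hB⟩ := exists_hasValue hf.summable T hT1
  refine ⟨B, hB, ContinuousLinearMap.opNorm_le_bound _ zero_le_one fun x => ?_⟩
  -- With `r` between all the `‖T j‖` and 1, the main estimate is applied to the strict contractions
  -- `r⁻¹ T j`, with `δ = √ε`.
  obtain ⟨r, hr0, hr1, hr⟩ : ∃ r : ℝ, 0 < r ∧ r < 1 ∧ ∀ j, ‖T j‖ < r := by
    have h : ∀ᶠ r in 𝓝[<] (1 : ℝ), r < 1 ∧ 0 < r ∧ ∀ j, ‖T j‖ < r :=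
      eventually_mem_nhdsWithin.and (eventually_nhdsWithin_of_eventually_nhds
        ((eventually_gt_nhds one_pos).and
          (eventually_all.2 fun j => eventually_gt_nhds (hT1 j))))
    obtain ⟨r, h1, h0, h2⟩ := h.exists
    exact ⟨r, h0, h1, h2⟩
  have hrc : (r : ℂ) ≠ 0 := by exact_mod_cast hr0.ne'
  rw [one_mul]
  refine le_of_sq_le_sq (le_of_forall_pos_le_add fun ε hε => ?_) (norm_nonneg _)
  have hS : Commuting fun j => (r : ℂ)⁻¹ • T j := fun i j => by
    simp only [smul_mul_smul_comm, hT i j]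
  have hS1 : ∀ j, ‖(r : ℂ)⁻¹ • T j‖ < 1 := fun j => by
    rw [norm_smul, norm_inv, Complex.norm_real, Real.norm_of_nonneg hr0.le, inv_mul_lt_iff₀ hr0,
      mul_one]
    exact hr j
  have := hf.norm_apply_le hf.summable _ hS hS1 hr0 hr1 B
    (by simpa [smul_smul, hrc, -Complex.coe_smul, -Complex.real_smul] using hB) x
      (Real.sqrt_pos.2 hε)
  rwa [Real.sq_sqrt hε.le] at this

/-- `f` is contractive on commuting strict contractions on Hilbert spaces in a fixed universe. -/
def OperatorContractive {d : ℕ} (f : (Fin d → ℂ) → ℂ) : Prop :=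
  ∀ (H : Type u) [NormedAddCommGroup H] [InnerProductSpace ℂ H] [CompleteSpace H]
    (T : Fin d → H →L[ℂ] H), Commuting T → (∀ j, ‖T j‖ < 1) → ValueContractive f T

/-- `ULift` only moves `ℂ^n` isometrically into the universe `u`. -/
lemma OperatorContractive.of_matrixOp {d : ℕ} {f : (Fin d → ℂ) → ℂ}
    (hf : OperatorContractive.{u} f) {n : ℕ} (T : Fin d → MatrixOp n) (hT : Commuting T)
    (hT1 : ∀ j, ‖T j‖ < 1) : ValueContractive f T := by
  let U : EuclideanSpace ℂ (Fin n) ≃ₗᵢ[ℂ] EuclideanSpace ℂ (ULift.{u} (Fin n)) :=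
    LinearIsometryEquiv.piLpCongrLeft 2 ℂ ℂ Equiv.ulift.symm
  have h := (hf _ (fun j => U.conjStarAlgEquiv (T j))
    (fun i j => by rw [← map_mul, ← map_mul, hT i j])
    (fun j => by rw [norm_conjStarAlgEquiv]; exact hT1 j)).conj U.symm
  convert h using 1
  funext j
  ext1 v
  simp [LinearIsometryEquiv.conjStarAlgEquiv_apply_apply]

lemma OperatorContractive.summable {d : ℕ} {f : (Fin d → ℂ) → ℂ}
    (hf : OperatorContractive.{u} f) (z : Fin d → ℂ) (hz : z ∈ polydisc d) :
    Summable fun α => ‖taylorCoeff f α‖ * ∏ j, ‖z j‖ ^ α j := by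
  obtain ⟨A, hA, -⟩ := hf.of_matrixOp (fun j => z j • (1 : MatrixOp 1))
    (fun i j => by simp [smul_smul, mul_comm])
    (fun j => by
      rw [norm_smul, norm_one, mul_one]
      exact hz j)
  exact hA.summable_of_eigenvector (v := EuclideanSpace.single 0 1) (by simp) (fun j => by simp)

/-- The rank-one operators on the right are the projections onto the lines of the eigenbasis.
Summing over `α` reduces `f(T)` to the values of `f` at the `l k`. -/
lemma tuplePow_eq_sum_of_eigenbasis {d n : ℕ} (T : Fin d → MatrixOp n)
    (b : Module.Basis (Fin n) ℂ (EuclideanSpace ℂ (Fin n))) (l : Fin n → Fin d → ℂ)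
    (hb : ∀ k j, T j (b k) = l k j • b k) (α : Fin d → ℕ) :
    tuplePow T α = ∑ k, (∏ j, l k j ^ α j) •
      (LinearMap.toContinuousLinearMap (b.coord k)).smulRight (b k) := by
  refine ContinuousLinearMap.coe_injective (b.ext fun i => ?_)
  simp [tuplePow_apply_eigenvector T (l i) (b i) (hb i), Finsupp.single_apply]

/-- As `‖T j‖ = 1` is allowed, the hypothesis applies only to `t T` with `t < 1`; the bound then
passes to the limit `t ↑ 1`. -/
lemma OperatorContractive.matrixContractive {d : ℕ} {f : (Fin d → ℂ) → ℂ}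
    (hf : OperatorContractive.{u} f) : MatrixContractive f := by
  rintro n T hT hT1 ⟨b, l, hb⟩ hspec
  have hl : ∀ k, l k ∈ polydisc d := fun k => hspec ⟨b k, b.ne_zero k, hb k⟩
  let E : Fin n → MatrixOp n := fun k =>
    (LinearMap.toContinuousLinearMap (b.coord k)).smulRight (b k)
  let s : Fin n → ℝ → ℂ := fun k t => ∑' α, taylorCoeff f α * ∏ j, ((t : ℂ) * l k j) ^ α j
  have hbound : ∀ k (t : ℝ), 0 ≤ t → t ≤ 1 → ∀ α : Fin d → ℕ,
      ‖taylorCoeff f α * ∏ j, ((t : ℂ) * l k j) ^ α j‖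
        ≤ ‖taylorCoeff f α‖ * ∏ j, ‖l k j‖ ^ α j := by
    intro k t h0 h1 α
    rw [norm_mul, norm_prod]
    refine mul_le_mul_of_nonneg_left (Finset.prod_le_prod (fun _ _ => norm_nonneg _) fun j _ => ?_)
      (norm_nonneg _)
    rw [norm_pow, norm_mul, Complex.norm_real, Real.norm_of_nonneg h0]
    exact pow_le_pow_left₀ (by positivity) (mul_le_of_le_one_left (norm_nonneg _) h1) _
  have hval : ∀ t : ℝ, 0 ≤ t → t ≤ 1 →
      HasValue f (fun j => (t : ℂ) • T j) (∑ k, s k t • E k) := by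
    intro t h0 h1
    have h : HasSum (fun α => ∑ k, (taylorCoeff f α * ∏ j, ((t : ℂ) * l k j) ^ α j) • E k)
        (∑ k, s k t • E k) :=
      hasSum_sum fun k _ => (Summable.of_norm_bounded (hf.summable (l k) (hl k))
        (hbound k t h0 h1)).hasSum.smul_const (E k)
    refine h.congr_fun fun α => ?_
    rw [tuplePow_eq_sum_of_eigenbasis (fun j => (t : ℂ) • T j) b (fun k j => (t : ℂ) * l k j)
      (fun k j => by rw [smul_apply, hb, smul_smul]), Finset.smul_sum]
    exact Finset.sum_congr rfl fun k _ => smul_smul _ _ _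
  have hlim : Tendsto (fun t => ∑ k, s k t • E k) (𝓝[<] 1) (𝓝 (∑ k, s k 1 • E k)) := by
    refine tendsto_finsetSum _ fun k _ => Tendsto.smul_const ?_ _
    -- The absolutely convergent series at `l k`, a point of the open polydisc, dominates for all
    -- `t` in `(0, 1)`.
    refine tendsto_tsum_of_dominated_convergence (hf.summable (l k) (hl k)) (fun α => ?_) ?_
    · have : Continuous fun t : ℝ => taylorCoeff f α * ∏ j, ((t : ℂ) * l k j) ^ α j := by
        fun_prop
      exact (this.tendsto 1).mono_left nhdsWithin_le_nhds
    · filter_upwards [Ioo_mem_nhdsLT (one_pos : (0 : ℝ) < 1)] with t ht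
      exact hbound k t ht.1.le ht.2.le
  refine ⟨∑ k, s k 1 • E k, by simpa using hval 1 zero_le_one le_rfl, ?_⟩
  refine le_of_tendsto hlim.norm ?_
  filter_upwards [Ioo_mem_nhdsLT (one_pos : (0 : ℝ) < 1)] with t ht
  obtain ⟨A, hA, hA1⟩ := hf.of_matrixOp (fun j => (t : ℂ) • T j)
    (fun i j => by simp only [smul_mul_smul_comm, hT i j])
    (fun j => by
      rw [norm_smul, Complex.norm_real, Real.norm_of_nonneg ht.1.le]
      exact (mul_le_of_le_one_right ht.1.le (hT1 j)).trans_lt ht.2)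
  rwa [HasSum.unique (hval t ht.1.le ht.2.le) hA]

end VonNeumann

end

theorem theorem5 (d : ℕ) (f : (Fin d → ℂ) → ℂ)
    (hf : AnalyticOnNhd ℂ f (VonNeumann.polydisc d)) :
    (∀ (H : Type u) [NormedAddCommGroup H] [InnerProductSpace ℂ H] [CompleteSpace H]
        (T : Fin d → H →L[ℂ] H),
        VonNeumann.Commuting T → (∀ j, ‖T j‖ < 1) → VonNeumann.ValueContractive f T) ↔
    (∀ (n : ℕ) (T : Fin d → VonNeumann.MatrixOp n),
        VonNeumann.Commuting T → (∀ j, ‖T j‖ ≤ 1) →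
        VonNeumann.SimultaneouslyDiagonalizable T →
        VonNeumann.jointSpectrum T ⊆ VonNeumann.polydisc d →
        VonNeumann.ValueContractive f T) :=
  ⟨fun h => VonNeumann.OperatorContractive.matrixContractive h,
    fun h _ _ _ _ T hT hT1 => VonNeumann.MatrixContractive.valueContractive h T hT hT1⟩
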